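/- Let $n\ge 2$ and consider a periodic chain of $n$ spin-$\frac12$ particles with $$H_0=\sum_{j=1}^{n-1}\sigma_z^j\sigma_z^{j+1}+\sigma_z^n\sigma_z^1,\qquad H_1=\sum_{j=1}^n\sigma_x^j,$$ where $\sigma^j$ is the tensor product of $n$ factors equal to the $2\times2$ identity $\mathbf 1$ except in position $j$, which is occupied by $\sigma$, and $$\sigma_x=\begin{pmatrix}0&1\\1&0\end{pmatrix},\qquad \sigma_y=\begin{pmatrix}0&i\\-i&0\end{pmatrix},\qquad \sigma_z=\begin{pmatrix}1&0\\0&-1\end{pmatrix}.$$ Let the dynamical Lie algebra $\mathcal L$ be the real Lie algebra of $2^n\times 2^n$ matrices (with the commutator bracket) generated by $iH_0$ and $iH_1$. Let $C_n$ be the cyclic group generated by the permutation of the $n$ tensor factors by the cycle $(1\,2\,\cdots\,n)$, set $\mathcal C(A)=\sum_{P\in C_n}PAP^{T}$, and for $0\le k\le n-2$ let $$\mathbf Y^k=i\,\mathcal C(\sigma_y\otimes\sigma_x^{\otimes k}\otimes\sigma_y\otimes\mathbf 1^{\otimes n-k-2}),\qquad \mathbf Z^k=i\,\mathcal C(\sigma_z\otimes\sigma_x^{\otimes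 k}\otimes\sigma_z\otimes\mathbf 1^{\otimes n-k-2}),$$ $$\mathbf X=i\,\mathcal C(\sigma_x\otimes\mathbf 1^{\otimes n-1}),\qquad \mathbf{XX}=i\,\mathcal C(\sigma_x^{\otimes n-1}\otimes\mathbf 1).$$ If $n$ is odd, the center of $\mathcal L$ is the real span of $$C^o_1=-\mathbf X+\sum_{\substack{0\le k\le n-2\\ k\text{ odd}}}(\mathbf Y^k+\mathbf Z^k),\qquad C^o_2=\mathbf{XX}+\sum_{\substack{0\le k\le n-2\\ k\text{ even}}}(\mathbf Y^k+\mathbf Z^k).$$ If $n$ is even, the center of $\mathcal L$ is the real span of $$C^e_1=-\mathbf X+\mathbf{XX}+\sum_{\substack{0\le k\le n-2\\ k\text{ odd}}}(\mathbf Y^k+\mathbf Z^k),\qquad C^e_2=\sum_{\substack{0\le k\le n-2\\ k\text{ even}}}(\mathbf Y^k+\mathbf Z^k).$$ If moreover $n\ge 3$, the center of $\mathcal L$ has real dimension $2$. -/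

import Mathlib

open scoped Matrix

attribute [local instance 100] LieRing.ofAssociativeRing

namespace IsingChain

/-- Operators on the state space of `n` spin-1/2 particles, `(ℂ²)^{⊗ n}`, as matrices in the
standard product basis, which is indexed by the functions `Fin n → Fin 2`. -/
abbrev Op (n : ℕ) : Type := Matrix (Fin n → Fin 2) (Fin n → Fin 2) ℂ

/-- The Pauli matrix `σ_x`. -/
def sigmaX : Matrix (Fin 2) (Fin 2) ℂ := !![0, 1; 1, 0]

/-- The Pauli matrix `σ_y`, with the sign convention for which `[iσ_x, iσ_y] = 2iσ_z`. -/
def sigmaY : Matrix (Fin 2) (Fin 2) ℂ := !![0, Complex.I; -Complex.I, 0]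

/-- The Pauli matrix `σ_z`. -/
def sigmaZ : Matrix (Fin 2) (Fin 2) ℂ := !![1, 0; 0, -1]

/-- The (Kronecker) tensor product `A 0 ⊗ A 1 ⊗ ⋯ ⊗ A (n-1)` of `2 × 2` matrices. -/
def tensor {n : ℕ} (A : Fin n → Matrix (Fin 2) (Fin 2) ℂ) : Op n :=
  Matrix.of fun r c => ∏ i, A i (r i) (c i)

/-- `σ^j`: the tensor product of identities, except in position `j`, which is occupied by `σ`. -/
def site {n : ℕ} (σ : Matrix (Fin 2) (Fin 2) ℂ) (j : Fin n) : Op n :=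
  tensor (Function.update (fun _ => 1) j σ)

/-- The Ising Hamiltonian `H₀ = ∑_j σ_z^j σ_z^{j+1}` of the periodic chain; `finRotate n` sends
the site `j` to `j + 1` and the last site to the first one. -/
def H0 (n : ℕ) : Op n := ∑ j : Fin n, site sigmaZ j * site sigmaZ (finRotate n j)

/-- The transverse field Hamiltonian `H₁ = ∑_j σ_x^j`. -/
def H1 (n : ℕ) : Op n := ∑ j : Fin n, site sigmaX j

/-- The dynamical Lie algebra: the real Lie algebra (with the commutator bracket) generated by
`i H₀` and `i H₁`. -/
noncomputable def dla (n : ℕ) : LieSubalgebra ℝ (Op n) :=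
  LieSubalgebra.lieSpan ℝ (Op n) {Complex.I • H0 n, Complex.I • H1 n}

/-- The operator on `(ℂ²)^{⊗ n}` that permutes the tensor factors by `p`; it maps the basis
vector of `c` to the basis vector of `c ∘ p⁻¹`. -/
def permOp {n : ℕ} (p : Equiv.Perm (Fin n)) : Op n :=
  Matrix.of fun r c => if r = c ∘ p.symm then 1 else 0

/-- The symmetrization `𝒞(A) = ∑_{P ∈ C_n} P A Pᵀ` over the cyclic group `C_n`, whose elements
are the powers `0, …, n-1` of the translation by one site. -/
def cyc {n : ℕ} (A : Op n) : Op n :=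
  ∑ m ∈ Finset.range n, permOp (finRotate n ^ m) * A * (permOp (finRotate n ^ m))ᵀ

/-- `A ⊗ σ_x^{⊗ j} ⊗ B ⊗ 1^{⊗ (n-j-2)}`, for `j + 2 ≤ n`. -/
def link (n : ℕ) (A B : Matrix (Fin 2) (Fin 2) ℂ) (j : ℕ) : Op n :=
  tensor fun i : Fin n =>
    if i.val = 0 then A else if i.val ≤ j then sigmaX else if i.val = j + 1 then B else 1

/-- `𝐘^j = i 𝒞(σ_y ⊗ σ_x^{⊗ j} ⊗ σ_y ⊗ 1^{⊗ (n-j-2)})`, for `j = 0, …, n-2`. -/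
noncomputable def Y (n j : ℕ) : Op n := Complex.I • cyc (link n sigmaY sigmaY j)

/-- `𝐙^j = i 𝒞(σ_z ⊗ σ_x^{⊗ j} ⊗ σ_z ⊗ 1^{⊗ (n-j-2)})`, for `j = 0, …, n-2`. -/
noncomputable def Z (n j : ℕ) : Op n := Complex.I • cyc (link n sigmaZ sigmaZ j)

/-- `𝐗 = i 𝒞(σ_x ⊗ 1^{⊗ (n-1)})`. -/
noncomputable def X (n : ℕ) : Op n :=
  Complex.I • cyc (tensor fun i : Fin n => if i.val = 0 then sigmaX else 1)

/-- `𝐗𝐗 = i 𝒞(σ_x^{⊗ (n-1)} ⊗ 1)`. -/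
noncomputable def XX (n : ℕ) : Op n :=
  Complex.I • cyc (tensor fun i : Fin n => if i.val + 1 < n then sigmaX else 1)

/-- The sum of `𝐘^k + 𝐙^k` over the odd `k` with `0 ≤ k ≤ n-2`. -/
noncomputable def oddSum (n : ℕ) : Op n :=
  ∑ k ∈ (Finset.range (n - 1)).filter (fun k => Odd k), (Y n k + Z n k)

/-- The sum of `𝐘^k + 𝐙^k` over the even `k` with `0 ≤ k ≤ n-2`. -/
noncomputable def evenSum (n : ℕ) : Op n :=
  ∑ k ∈ (Finset.range (n - 1)).filter (fun k => Even k), (Y n k + Z n k)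

/-- The center of the dynamical Lie algebra, as a real subspace of the space of operators. -/
noncomputable def dlaCenter (n : ℕ) : Submodule ℝ (Op n) :=
  (LieAlgebra.center ℝ (dla n)).toSubmodule.map (dla n).toSubmodule.subtype

end IsingChain

/-! Put e_{2k} = iσ_x^k and e_{2k+1} = iσ_z^k σ_z^{k+1}, with indices modulo 2n (`bond`). Each
squares to -1, cyclic neighbours anticommute, and all other pairs commute. Let a_m and b_m be the
sums over translates of products of 2m+1 consecutive e_r starting at an even, respectively odd,
index, and let G_m be the even-start sum minus the odd-start sum for length 2m (`layer`). Then a_0 =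
iH_1, b_0 = iH_0, and brackets with these two follow the Onsager algebra (`onsagerRelations_layer`).
The product once around the ring does not depend on its starting point (`chainProd_bond_full`), so
G_n = 0, and the algebra is spanned by the a_m, b_m with m < n and by G_1, …, G_{n-1}.

Let α_m, β_m be the coefficients of a_m, b_m in a central element. Commuting with a_0 and b_0 kills
the G-part and forces α_{m+1} = -β_m and β_{m+1} = -α_m, so only α_0 and β_0 are free. The solutions
are spanned by -a_0 + b_1 - a_2 + … and b_0 - a_1 + b_2 - … (`mem_lieSpan_and_central_iff`). The
dictionary X = a_0, Y^k = -a_{k+1}, Z^k = b_k, XX = b_{n-1} turns these into the stated elements.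

Linear independence is tested in two ways: complex conjugation separates the G_m from the a_m and
b_m, and expectations in product states send Z^k to a multiple of x^k. -/

namespace IsingChain

/-! ### Products of consecutive generators in an abstract ring. -/

section ChainProd

variable {R : Type*} [Ring R]

/-- The product `e p * e (p + 1) * ⋯ * e (p + l - 1)`. -/
def chainProd (e : ℕ → R) (p : ℕ) : ℕ → R
  | 0 => 1
  | l + 1 => chainProd e p l * e (p + l)

@[simp] lemma chainProd_zero (e : ℕ → R) (p : ℕ) : chainProd e p 0 = 1 := rfl

lemma chainProd_succ (e : ℕ → R) (p l : ℕ) :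
    chainProd e p (l + 1) = chainProd e p l * e (p + l) := rfl

@[simp] lemma chainProd_one (e : ℕ → R) (p : ℕ) : chainProd e p 1 = e p := by
  simp [chainProd_succ]

lemma chainProd_succ' (e : ℕ → R) (p l : ℕ) :
    chainProd e p (l + 1) = e p * chainProd e (p + 1) l := by
  induction l with
  | zero => simp
  | succ l ih => rw [chainProd_succ, ih, chainProd_succ, mul_assoc]; congr 3; ring

lemma chainProd_congr {e f : ℕ → R} {p q : ℕ} (h : ∀ i, e (p + i) = f (q + i)) (l : ℕ) :
    chainProd e p l = chainProd f q l := by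
  induction l with
  | zero => rfl
  | succ l ih => rw [chainProd_succ, chainProd_succ, ih, h]

lemma map_chainProd {S : Type*} [Ring S] (φ : R →+* S) (e : ℕ → R) (p l : ℕ) :
    φ (chainProd e p l) = chainProd (fun r => φ (e r)) p l := by
  induction l with
  | zero => simp
  | succ l ih => rw [chainProd_succ, chainProd_succ, map_mul, ih]

lemma chainProd_neg (e : ℕ → R) (p l : ℕ) :
    chainProd (fun r => -e r) p l = (-1) ^ l * chainProd e p l := by
  induction l with
  | zero => simp
  | succ l ih => rw [chainProd_succ, chainProd_succ, ih, pow_succ]; noncomm_ring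

lemma commute_chainProd {e : ℕ → R} {a : R} {p l : ℕ} (h : ∀ i < l, Commute a (e (p + i))) :
    Commute a (chainProd e p l) := by
  induction l with
  | zero => exact Commute.one_right a
  | succ l ih =>
    rw [chainProd_succ]
    exact (ih fun i hi => h i (by omega)).mul_right (h l (by omega))

/-- `Q` stands for the sum of all generators with the parity of `p`. Contributions from inside the
string cancel, so the commutator only lengthens or shortens the string at its two ends. -/
lemma chainProd_comm_aligned {e : ℕ → R} {Q : R} {p : ℕ} (hsq : ∀ r, e r * e r = -1)
    (h0 : ∀ i, e (p + 2 * i) * Q - Q * e (p + 2 * i) = 0)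
    (h1 : ∀ i, e (p + 2 * i + 1) * Q - Q * e (p + 2 * i + 1) =
      2 * (e (p + 2 * i + 1) * e (p + 2 * i + 2)) - 2 * (e (p + 2 * i) * e (p + 2 * i + 1)))
    (m : ℕ) :
    chainProd e p (2 * m + 1) * Q - Q * chainProd e p (2 * m + 1) =
        2 * chainProd e (p + 1) (2 * m) - 2 * chainProd e p (2 * m) ∧
      chainProd e p (2 * m + 2) * Q - Q * chainProd e p (2 * m + 2) =
        2 * chainProd e (p + 1) (2 * m + 1) + 2 * chainProd e p (2 * m + 3) := by
  have step : ∀ m, chainProd e p (2 * m + 1) * Q - Q * chainProd e p (2 * m + 1) =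
        2 * chainProd e (p + 1) (2 * m) - 2 * chainProd e p (2 * m) →
      chainProd e p (2 * m + 2) * Q - Q * chainProd e p (2 * m + 2) =
        2 * chainProd e (p + 1) (2 * m + 1) + 2 * chainProd e p (2 * m + 3) := by
    intro m h
    have e1 := chainProd_succ e p (2 * m)
    have e2 := chainProd_succ e p (2 * m + 1)
    have e3 := chainProd_succ e p (2 * m + 2)
    have e4 := chainProd_succ e (p + 1) (2 * m)
    have h1 := h1 m
    have hs := hsq (p + 2 * m)
    simp only [← add_assoc, show p + 1 + 2 * m = p + 2 * m + 1 by ring] at e1 e2 e3 e4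
    change chainProd e p (2 * m + 2) = _ at e2
    rw [show 2 * m + 3 = 2 * m + 2 + 1 by ring, e3, e4, e2]
    clear e2 e3
    generalize e (p + 2 * m) = a at *
    generalize e (p + 2 * m + 1) = b at *
    generalize e (p + 2 * m + 2) = c at *
    generalize chainProd e p (2 * m + 1) = A at *
    generalize chainProd e p (2 * m) = A0 at *
    generalize chainProd e (p + 1) (2 * m) = B at *
    subst e1
    -- The interior terms cancel: `a * a = -1` turns `-2 * A0 * a * a * b` into `2 * A0 * b`,
    -- against the `-2 * A0 * b` from the induction.
    linear_combination (norm := noncomm_ring) h * b + A0 * a * h1 - 2 * (A0 * hs * b)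
  induction m with
  | zero =>
    have := h0 0
    have h : chainProd e p (2 * 0 + 1) * Q - Q * chainProd e p (2 * 0 + 1) =
        2 * chainProd e (p + 1) (2 * 0) - 2 * chainProd e p (2 * 0) := by simpa using this
    exact ⟨h, step 0 h⟩
  | succ m ih =>
    suffices h : _ from ⟨h, step _ h⟩
    have h := ih.2
    have e2 := chainProd_succ e p (2 * m + 1)
    have e3 := chainProd_succ e p (2 * m + 2)
    have e4 := chainProd_succ e (p + 1) (2 * m + 1)
    have h0 := h0 (m + 1)
    have hs := hsq (p + 2 * m + 2)
    simp only [← add_assoc, mul_add, show p + 1 + 2 * m = p + 2 * m + 1 by ring, mul_one] at *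
    norm_num [add_assoc] at *
    rw [e3] at h ⊢
    rw [e4]
    generalize e (p + (2 * m + 2)) = a at *
    linear_combination (norm := noncomm_ring) h * a + chainProd e p (2 * m + 2) * h0 +
      2 * (chainProd e p (2 * m + 2) * hs)

/-- Reduces to the aligned case: a string from `p + 1` is `-e p` times the one from `p`, and `e p`
commutes with `Q`. -/
lemma chainProd_comm_shifted {e : ℕ → R} {Q : R} {p : ℕ} (hsq : ∀ r, e r * e r = -1)
    (h0 : ∀ i, e (p + 2 * i) * Q - Q * e (p + 2 * i) = 0)
    (h1 : ∀ i, e (p + 2 * i + 1) * Q - Q * e (p + 2 * i + 1) =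
      2 * (e (p + 2 * i + 1) * e (p + 2 * i + 2)) - 2 * (e (p + 2 * i) * e (p + 2 * i + 1)))
    (m : ℕ) :
    chainProd e (p + 1) (2 * m + 1) * Q - Q * chainProd e (p + 1) (2 * m + 1) =
        2 * chainProd e (p + 1) (2 * m + 2) - 2 * chainProd e p (2 * m + 2) ∧
      chainProd e (p + 1) (2 * m + 2) * Q - Q * chainProd e (p + 1) (2 * m + 2) =
        -(2 * chainProd e p (2 * m + 3)) - 2 * chainProd e (p + 1) (2 * m + 1) := by
  have key := chainProd_comm_aligned hsq h0 h1
  have hp := h0 0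
  have hs := hsq p
  have conv : ∀ l, chainProd e (p + 1) l = -(e p * chainProd e p (l + 1)) := by
    intro l
    rw [chainProd_succ', ← mul_assoc, hs]; simp
  have e1 := chainProd_succ' e p (2 * m + 1)
  have e2 := chainProd_succ' e p (2 * m + 2)
  have k1 := (key m).2
  have k2 := (key (m + 1)).1
  simp only [mul_zero, add_zero] at hp
  simp only [mul_add, mul_one, add_assoc] at *
  norm_num at *
  rw [e1] at k1
  rw [e2] at k2
  rw [e1, e2]
  rw [e2] at k1
  rw [e1] at k2
  generalize chainProd e (p + 1) (2 * m + 1) = A at *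
  generalize chainProd e (p + 1) (2 * m + 2) = B at *
  generalize e p = a at *
  constructor
  · linear_combination (norm := noncomm_ring) -(a * k1) + a * hp * A + hs * (A * Q - Q * A) -
      2 * (hs * B)
  · linear_combination (norm := noncomm_ring) -(a * k2) + a * hp * B + hs * (B * Q - Q * B) +
      2 * (hs * A)

end ChainProd

lemma sum_range_periodic {M : Type*} [AddCommMonoid M] {n : ℕ} {f : ℕ → M}
    (hf : ∀ j, f (j + n) = f j) (a : ℕ) :
    ∑ j ∈ Finset.range n, f (j + a) = ∑ j ∈ Finset.range n, f j := by
  induction a with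
  | zero => rfl
  | succ a ih =>
    rw [← ih]
    cases n with
    | zero => rfl
    | succ n =>
      rw [Finset.sum_range_succ, Finset.sum_range_succ' (fun j => f (j + a))]
      congr 1
      · exact Finset.sum_congr rfl fun j _ => congrArg f (by ring)
      · rw [← hf (0 + a)]; exact congrArg f (by ring)

/-! ### Tensor products, single-site operators and translations. -/

section Tensor

variable {n : ℕ}

lemma tensor_mul (A B : Fin n → Matrix (Fin 2) (Fin 2) ℂ) :
    tensor A * tensor B = tensor fun i => A i * B i := by
  ext r c
  simp only [tensor, Matrix.mul_apply, Matrix.of_apply, ← Finset.prod_mul_distrib]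
  rw [Finset.prod_univ_sum, Fintype.piFinset_univ]

lemma tensor_one : tensor (fun _ : Fin n => 1) = 1 := by
  ext r c
  simp only [tensor, Matrix.of_apply, Matrix.one_apply]
  by_cases h : r = c
  · simp [h]
  · rw [if_neg h]
    obtain ⟨i, hi⟩ := Function.ne_iff.1 h
    exact Finset.prod_eq_zero (Finset.mem_univ i) (if_neg hi)

lemma trace_tensor (A : Fin n → Matrix (Fin 2) (Fin 2) ℂ) :
    (tensor A).trace = ∏ i, (A i).trace := by
  simp only [tensor, Matrix.trace, Matrix.diag_apply, Matrix.of_apply]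
  rw [Finset.prod_univ_sum, Fintype.piFinset_univ]

lemma tensor_smul_update (A : Fin n → Matrix (Fin 2) (Fin 2) ℂ) (j : Fin n) (c : ℂ)
    (σ : Matrix (Fin 2) (Fin 2) ℂ) :
    tensor (Function.update A j (c • σ)) = c • tensor (Function.update A j σ) := by
  ext r s
  simp only [tensor, Matrix.of_apply, Matrix.smul_apply, smul_eq_mul]
  rw [Fintype.prod_eq_mul_prod_compl j, Fintype.prod_eq_mul_prod_compl j]
  simp only [Function.update_self, Matrix.smul_apply, smul_eq_mul, mul_assoc]
  congr 2
  refine Finset.prod_congr rfl fun i hi => ?_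
  have : i ≠ j := by simpa using hi
  simp [this]

lemma site_smul (σ : Matrix (Fin 2) (Fin 2) ℂ) (c : ℂ) (j : Fin n) :
    site (c • σ) j = c • site σ j := tensor_smul_update _ _ _ _

lemma site_one (j : Fin n) : site 1 j = 1 := by
  rw [site, Function.update_eq_self_iff.2 rfl, tensor_one]

lemma site_mul_site_self (σ τ : Matrix (Fin 2) (Fin 2) ℂ) (j : Fin n) :
    site σ j * site τ j = site (σ * τ) j := by
  rw [site, site, tensor_mul, site]
  congr 1
  ext1 i
  by_cases h : i = j
  · subst h; simp
  · simp [h]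

lemma commute_site (σ τ : Matrix (Fin 2) (Fin 2) ℂ) {j k : Fin n} (h : j ≠ k) :
    Commute (site σ j) (site τ k) := by
  rw [Commute, SemiconjBy, site, site, tensor_mul, tensor_mul]
  congr 1
  ext1 i
  by_cases hj : i = j
  · subst hj; simp [h]
  · simp [hj]

lemma commute_site_self (σ : Matrix (Fin 2) (Fin 2) ℂ) (j k : Fin n) :
    Commute (site σ j) (site σ k) := by
  by_cases h : j = k
  · rw [h]
  · exact commute_site σ σ h

/-- Relabelling of the basis vectors by a permutation of the tensor factors. -/
def factorPerm (p : Equiv.Perm (Fin n)) : Equiv.Perm (Fin n → Fin 2) :=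
  p.arrowCongr (Equiv.refl _)

/-- Recasting the conjugation as an algebra automorphism lets translations pass through products. -/
lemma permOp_conj (p : Equiv.Perm (Fin n)) (A : Op n) :
    permOp p * A * (permOp p)ᵀ = Matrix.reindexAlgEquiv ℂ ℂ (factorPerm p) A := by
  have h : ∀ r s : Fin n → Fin 2, r = s ∘ p.symm ↔ s = (factorPerm p).symm r := by
    intro r s
    rw [Equiv.eq_symm_apply]
    exact eq_comm
  ext r c
  simp [Matrix.mul_apply, permOp, h]

lemma reindex_tensor (p : Equiv.Perm (Fin n)) (A : Fin n → Matrix (Fin 2) (Fin 2) ℂ) :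
    Matrix.reindexAlgEquiv ℂ ℂ (factorPerm p) (tensor A) = tensor (A ∘ p.symm) := by
  ext r c
  simp only [Matrix.coe_reindexAlgEquiv, Matrix.reindex_apply, Matrix.submatrix_apply, tensor,
    Matrix.of_apply, Function.comp_apply]
  rw [← Equiv.prod_comp p.symm]
  simp [factorPerm, Equiv.arrowCongr]

lemma reindex_site (p : Equiv.Perm (Fin n)) (σ : Matrix (Fin 2) (Fin 2) ℂ) (j : Fin n) :
    Matrix.reindexAlgEquiv ℂ ℂ (factorPerm p) (site σ j) = site σ (p j) := by
  rw [site, reindex_tensor, site]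
  congr 1
  ext1 i
  simp [Function.update_apply, Equiv.symm_apply_eq]

lemma cyc_eq_sum (A : Op n) :
    cyc A = ∑ m ∈ Finset.range n,
      Matrix.reindexAlgEquiv ℂ ℂ (factorPerm (finRotate n ^ m)) A := by
  simp only [cyc, permOp_conj]

lemma cyc_smul (c : ℂ) (A : Op n) : cyc (c • A) = c • cyc A := by
  simp only [cyc_eq_sum, map_smul, Finset.smul_sum]

variable [NeZero n]

/-- `σ` at the site `k` counted modulo `n`. -/
def siteMod (n : ℕ) [NeZero n] (σ : Matrix (Fin 2) (Fin 2) ℂ) (k : ℕ) : Op n :=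
  site σ (Fin.ofNat n k)

lemma siteMod_add (σ : Matrix (Fin 2) (Fin 2) ℂ) (k : ℕ) :
    siteMod n σ (k + n) = siteMod n σ k := by
  simp [siteMod, Fin.ofNat]

lemma siteMod_val (σ : Matrix (Fin 2) (Fin 2) ℂ) (j : Fin n) :
    siteMod n σ j = site σ j := by
  simp [siteMod]

lemma finRotate_ofNat (k : ℕ) : finRotate n (Fin.ofNat n k) = Fin.ofNat n (k + 1) := by
  rw [finRotate_apply]
  ext
  simp [Fin.val_add, Fin.ofNat]

lemma finRotate_pow_ofNat (m k : ℕ) :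
    (finRotate n ^ m) (Fin.ofNat n k) = Fin.ofNat n (k + m) := by
  induction m with
  | zero => simp
  | succ m ih => rw [pow_succ', Equiv.Perm.mul_apply, ih, finRotate_ofNat, add_assoc]

lemma reindex_siteMod (σ : Matrix (Fin 2) (Fin 2) ℂ) (m k : ℕ) :
    Matrix.reindexAlgEquiv ℂ ℂ (factorPerm (finRotate n ^ m)) (siteMod n σ k) =
      siteMod n σ (k + m) := by
  rw [siteMod, reindex_site, finRotate_pow_ofNat, siteMod]

lemma commute_siteMod (σ τ : Matrix (Fin 2) (Fin 2) ℂ) {j k : ℕ} (h : ¬ j ≡ k [MOD n]) :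
    Commute (siteMod n σ j) (siteMod n τ k) :=
  commute_site σ τ fun hjk => h (congrArg Fin.val hjk)

lemma commute_siteMod_self (σ : Matrix (Fin 2) (Fin 2) ℂ) (j k : ℕ) :
    Commute (siteMod n σ j) (siteMod n σ k) := commute_site_self _ _ _

lemma siteMod_mul (σ τ : Matrix (Fin 2) (Fin 2) ℂ) (j : ℕ) :
    siteMod n σ j * siteMod n τ j = siteMod n (σ * τ) j := site_mul_site_self _ _ _

lemma siteMod_smul (c : ℂ) (σ : Matrix (Fin 2) (Fin 2) ℂ) (j : ℕ) :
    siteMod n (c • σ) j = c • siteMod n σ j := site_smul _ _ _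

lemma siteMod_one (j : ℕ) : siteMod n 1 j = 1 := site_one _

lemma sigmaX_mul_self : sigmaX * sigmaX = 1 := by
  ext i j; fin_cases i <;> fin_cases j <;> simp [sigmaX]

lemma sigmaZ_mul_self : sigmaZ * sigmaZ = 1 := by
  ext i j; fin_cases i <;> fin_cases j <;> simp [sigmaZ]

lemma sigmaX_mul_sigmaZ : sigmaX * sigmaZ = Complex.I • sigmaY := by
  ext i j; fin_cases i <;> fin_cases j <;> simp [sigmaX, sigmaZ, sigmaY]

lemma sigmaZ_mul_sigmaX : sigmaZ * sigmaX = (-Complex.I) • sigmaY := by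
  ext i j; fin_cases i <;> fin_cases j <;> simp [sigmaX, sigmaZ, sigmaY]

lemma siteX_sq (j : ℕ) : siteMod n sigmaX j * siteMod n sigmaX j = 1 := by
  rw [siteMod_mul, sigmaX_mul_self, siteMod_one]

lemma siteZ_sq (j : ℕ) : siteMod n sigmaZ j * siteMod n sigmaZ j = 1 := by
  rw [siteMod_mul, sigmaZ_mul_self, siteMod_one]

lemma siteX_mul_siteZ (j : ℕ) :
    siteMod n sigmaX j * siteMod n sigmaZ j = Complex.I • siteMod n sigmaY j := by
  rw [siteMod_mul, sigmaX_mul_sigmaZ, siteMod_smul]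

lemma siteZ_mul_siteX (j : ℕ) :
    siteMod n sigmaZ j * siteMod n sigmaX j = -(Complex.I • siteMod n sigmaY j) := by
  rw [siteMod_mul, sigmaZ_mul_sigmaX, siteMod_smul, neg_smul]

lemma siteZ_anticomm (j : ℕ) :
    siteMod n sigmaZ j * siteMod n sigmaX j = -(siteMod n sigmaX j * siteMod n sigmaZ j) := by
  rw [siteZ_mul_siteX, siteX_mul_siteZ]

lemma tensor_mul_siteMod (A : Fin n → Matrix (Fin 2) (Fin 2) ℂ) (σ : Matrix (Fin 2) (Fin 2) ℂ)
    {k : ℕ} (hk : k < n) :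
    tensor A * siteMod n σ k = tensor fun i => if i.val = k then A i * σ else A i := by
  rw [siteMod, site, tensor_mul]
  congr 1
  ext1 i
  have : i = Fin.ofNat n k ↔ i.val = k := by simp [Fin.ext_iff, Fin.ofNat, Nat.mod_eq_of_lt hk]
  by_cases h : i.val = k
  · simp [this.2 h, Nat.mod_eq_of_lt hk]
  · rw [Function.update_of_ne (fun h' => h (this.1 h')), if_neg h, mul_one]

lemma siteMod_mul_chainProd (A : Matrix (Fin 2) (Fin 2) ℂ) {m : ℕ} (hm : m < n) :
    siteMod n A 0 * chainProd (siteMod n sigmaX) 1 m =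
      tensor fun i => if i.val = 0 then A else if i.val ≤ m then sigmaX else 1 := by
  induction m with
  | zero =>
    rw [chainProd_zero, mul_one, siteMod, site]
    congr 1
    ext1 i
    by_cases h : i = 0
    · subst h; simp
    · have : i.val ≠ 0 := fun h' => h (Fin.ext h')
      simp [h]
  | succ m ih =>
    rw [chainProd_succ, ← mul_assoc, ih (by omega), add_comm 1 m, tensor_mul_siteMod _ _ hm]
    congr 1
    ext1 i
    split_ifs <;> first | omega | simp

lemma siteMod_mul_chainProd_mul (A B : Matrix (Fin 2) (Fin 2) ℂ) {m : ℕ} (hm : m + 1 < n) :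
    siteMod n A 0 * chainProd (siteMod n sigmaX) 1 m * siteMod n B (m + 1) = link n A B m := by
  rw [siteMod_mul_chainProd A (by omega), tensor_mul_siteMod _ _ hm, link]
  congr 1
  ext1 i
  split_ifs <;> first | omega | simp

end Tensor

/-! ### Bond generators on the ring and their translation-invariant sums. -/

section Bond

variable (n : ℕ) [NeZero n]

/-- The bond generators: `bond (2 k) = i σ_x^k` and `bond (2 k + 1) = i σ_z^k σ_z^{k+1}`. Products
of consecutive ones are, up to sign, the products of two Majorana operators of the chain. -/
noncomputable def bond (r : ℕ) : Op n :=
  Complex.I • if Even r then siteMod n sigmaX (r / 2)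
    else siteMod n sigmaZ (r / 2) * siteMod n sigmaZ (r / 2 + 1)

lemma bond_even (k : ℕ) : bond n (2 * k) = Complex.I • siteMod n sigmaX k := by
  simp [bond]

lemma bond_odd (k : ℕ) :
    bond n (2 * k + 1) = Complex.I • (siteMod n sigmaZ k * siteMod n sigmaZ (k + 1)) := by
  have : ¬ Even (2 * k + 1) := by simp
  rw [bond, if_neg this, show (2 * k + 1) / 2 = k by omega]

lemma bond_add (r : ℕ) : bond n (r + 2 * n) = bond n r := by
  obtain ⟨k, rfl | rfl⟩ := Nat.even_or_odd' r
  · rw [← mul_add, bond_even, bond_even, siteMod_add]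
  · rw [show 2 * k + 1 + 2 * n = 2 * (k + n) + 1 by ring, bond_odd, bond_odd, siteMod_add,
      show k + n + 1 = k + 1 + n by ring, siteMod_add]

lemma bond_sq (r : ℕ) : bond n r * bond n r = -1 := by
  obtain ⟨k, rfl | rfl⟩ := Nat.even_or_odd' r
  · rw [bond_even, smul_mul_smul_comm, siteX_sq, Complex.I_mul_I, neg_one_smul]
  · rw [bond_odd, smul_mul_smul_comm, Complex.I_mul_I, neg_one_smul,
      (commute_siteMod_self (n := n) sigmaZ (k + 1) k).mul_mul_mul_comm, siteZ_sq, siteZ_sq,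
      one_mul]

variable {n}

lemma bond_anticomm (hn : 2 ≤ n) (r : ℕ) :
    bond n (r + 1) * bond n r = -(bond n r * bond n (r + 1)) := by
  have hne : ∀ k, ¬ k ≡ k + 1 [MOD n] := by
    intro k h
    have := (Nat.modEq_iff_dvd' (by omega)).1 h
    have := Nat.le_of_dvd (by omega) this
    omega
  obtain ⟨k, rfl | rfl⟩ := Nat.even_or_odd' r
  · have h1 := siteZ_anticomm (n := n) k
    have h2 := (commute_siteMod sigmaX sigmaZ (hne k)).eq
    rw [bond_odd, bond_even, smul_mul_smul_comm, smul_mul_smul_comm, ← smul_neg]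
    congr 1
    rw [mul_assoc, ← h2, ← mul_assoc, h1, neg_mul, mul_assoc]
  · have h1 := siteZ_anticomm (n := n) (k + 1)
    have h2 := (commute_siteMod sigmaZ sigmaX (hne k)).eq
    rw [show 2 * k + 1 + 1 = 2 * (k + 1) by ring, bond_odd, bond_even, smul_mul_smul_comm,
      smul_mul_smul_comm, ← smul_neg]
    congr 1
    rw [← mul_assoc, ← h2, mul_assoc, mul_assoc, h1, mul_neg, neg_neg]

lemma commute_bond {r i : ℕ} (h2 : 2 ≤ i) (hi : i + 2 ≤ 2 * n) :
    Commute (bond n r) (bond n (r + i)) := by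
  have hne : ∀ j k, j < k → k < j + n → ¬ j ≡ k [MOD n] := by
    intro j k h h' H
    have := (Nat.modEq_iff_dvd' h.le).1 H
    have := Nat.le_of_dvd (by omega) this
    omega
  obtain ⟨k, rfl | rfl⟩ := Nat.even_or_odd' r <;> obtain ⟨t, rfl | rfl⟩ := Nat.even_or_odd' i
  · rw [← mul_add, bond_even, bond_even]
    exact ((commute_siteMod_self _ _ _).smul_left _).smul_right _
  · rw [← add_assoc, ← mul_add, bond_even, bond_odd]
    refine Commute.smul_left (Commute.smul_right (Commute.mul_right ?_ ?_) _) _ <;>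
      exact commute_siteMod _ _ (hne _ _ (by omega) (by omega))
  · rw [show 2 * k + 1 + 2 * t = 2 * (k + t) + 1 by ring, bond_odd, bond_odd]
    refine Commute.smul_left (Commute.smul_right (Commute.mul_right (Commute.mul_left ?_ ?_)
      (Commute.mul_left ?_ ?_)) _) _ <;> exact commute_siteMod_self _ _ _
  · rw [show 2 * k + 1 + (2 * t + 1) = 2 * (k + t + 1) by ring, bond_odd, bond_even]
    refine Commute.smul_left (Commute.smul_right (Commute.mul_left ?_ ?_) _) _ <;>
      exact commute_siteMod _ _ (hne _ _ (by omega) (by omega))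

lemma commute_bond_even (r i : ℕ) : Commute (bond n r) (bond n (r + 2 * i)) := by
  obtain ⟨k, rfl | rfl⟩ := Nat.even_or_odd' r
  · rw [← mul_add, bond_even, bond_even]
    exact ((commute_siteMod_self _ _ _).smul_left _).smul_right _
  · rw [show 2 * k + 1 + 2 * i = 2 * (k + i) + 1 by ring, bond_odd, bond_odd]
    refine Commute.smul_left (Commute.smul_right (Commute.mul_right (Commute.mul_left ?_ ?_)
      (Commute.mul_left ?_ ?_)) _) _ <;> exact commute_siteMod_self _ _ _

lemma chainProd_bond_add (p l : ℕ) :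
    chainProd (bond n) (p + 2 * n) l = chainProd (bond n) p l :=
  chainProd_congr (fun i => by rw [add_right_comm, bond_add]) l

/-- Moving the first factor to the end passes exactly two anticommuting neighbours, at `p + 1` and
`p + 2 * n - 1`, and the two signs cancel. -/
lemma chainProd_bond_full (hn : 2 ≤ n) (p : ℕ) :
    chainProd (bond n) (p + 1) (2 * n) = chainProd (bond n) p (2 * n) := by
  obtain ⟨m, rfl⟩ := Nat.exists_eq_add_of_le hn
  set e := bond (2 + m) with he
  have hp : e (p + (2 * m + 4)) = e p := by
    rw [he, ← bond_add (2 + m) p]; congr 1; ring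
  have a1 := bond_anticomm hn p
  have a2 := bond_anticomm hn (p + (2 * m + 3))
  rw [← he, show p + (2 * m + 3) + 1 = p + (2 * m + 4) by ring, hp] at a2
  rw [← he] at a1
  have hc : Commute (e p) (chainProd e (p + 1 + 1) (2 * m + 1)) := by
    refine commute_chainProd fun i hi => ?_
    rw [show p + 1 + 1 + i = p + (i + 2) by ring]
    exact commute_bond (by omega) (by omega)
  rw [show 2 * (2 + m) = 2 * m + 3 + 1 by ring, chainProd_succ' e p, chainProd_succ,
    show p + 1 + (2 * m + 3) = p + (2 * m + 4) by ring, hp, chainProd_succ, chainProd_succ',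
    show p + 1 + (2 * m + 2) = p + (2 * m + 3) by ring]
  have hc := hc.eq
  generalize chainProd e (p + 1 + 1) (2 * m + 1) = A at *
  linear_combination (norm := noncomm_ring) e (p + 1) * A * a2 - a1 * A * e (p + (2 * m + 3)) +
    e (p + 1) * hc * e (p + (2 * m + 3))

variable (n) in
/-- The translation-invariant sums of chain products of `l` bond generators. -/
noncomputable def layer (c l : ℕ) : Op n :=
  ∑ j ∈ Finset.range n, chainProd (bond n) (2 * j + c) l

lemma layer_add_two (c l : ℕ) : layer n (c + 2) l = layer n c l := by
  rw [layer, layer, ← sum_range_periodic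
    (f := fun j => chainProd (bond n) (2 * j + c) l) (n := n) _ 1]
  · exact Finset.sum_congr rfl fun j _ => by congr 1; ring
  · intro j
    rw [show 2 * (j + n) + c = 2 * j + c + 2 * n by ring, chainProd_bond_add]

lemma layer_zero (c : ℕ) : layer n c 0 = layer n 0 0 := by simp [layer]

lemma layer_full (hn : 2 ≤ n) : layer n 1 (2 * n) = layer n 0 (2 * n) :=
  Finset.sum_congr rfl fun j _ => chainProd_bond_full hn (2 * j)

lemma layer_one_eq (c j : ℕ) :
    layer n c 1 = ∑ i ∈ Finset.range n, bond n (2 * j + c + 2 * i) := by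
  simp only [layer, chainProd_one]
  rw [← sum_range_periodic (f := fun j => bond n (2 * j + c)) (n := n) _ j]
  · exact Finset.sum_congr rfl fun i _ => by congr 1; ring
  · intro j
    rw [show 2 * (j + n) + c = 2 * j + c + 2 * n by ring, bond_add]

lemma bond_comm_layer_even (c j : ℕ) :
    bond n (2 * j + c) * layer n c 1 - layer n c 1 * bond n (2 * j + c) = 0 := by
  rw [layer_one_eq c j, sub_eq_zero]
  exact Commute.sum_right _ _ _ fun i _ => commute_bond_even _ _

/-- Among the `n` summands only the two neighbours of the bond fail to commute with it. They are
split off from the other `n - 2`. -/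
lemma bond_comm_layer_odd (hn : 2 ≤ n) (c j : ℕ) :
    bond n (2 * j + c + 1) * layer n c 1 - layer n c 1 * bond n (2 * j + c + 1) =
      2 * (bond n (2 * j + c + 1) * bond n (2 * j + c + 2)) -
        2 * (bond n (2 * j + c) * bond n (2 * j + c + 1)) := by
  rw [layer_one_eq c j]
  generalize 2 * j + c = p
  have h : ∀ m, n = m + 2 → Commute (bond n (p + 1))
      (∑ i ∈ Finset.range m, bond n (p + 2 * (i + 1 + 1))) := by
    intro m hm
    refine Commute.sum_right _ _ _ fun i hi => ?_
    have := Finset.mem_range.1 hi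
    rw [show p + 2 * (i + 1 + 1) = p + 1 + (2 * i + 3) by ring]
    exact commute_bond (by omega) (by omega)
  have hs : ∀ (e : ℕ → Op n) (N m : ℕ), N = m + 2 → ∑ i ∈ Finset.range N, e (p + 2 * i) =
      ∑ i ∈ Finset.range m, e (p + 2 * (i + 1 + 1)) + e (p + 2) + e p := by
    rintro e N m rfl
    rw [Finset.sum_range_succ', Finset.sum_range_succ']
    simp
  obtain ⟨m, hm⟩ := Nat.exists_eq_add_of_le' hn
  rw [hs _ n m hm]
  have hc := (h m hm).eq
  have a1 := bond_anticomm hn p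
  have a2 := bond_anticomm hn (p + 1)
  rw [add_assoc p 1 1] at a2
  linear_combination (norm := noncomm_ring) hc + a1 - a2

lemma layer_comm_aligned (hn : 2 ≤ n) (c m : ℕ) :
    ⁅layer n c (2 * m + 1), layer n c 1⁆ =
        2 * layer n (c + 1) (2 * m) - 2 * layer n c (2 * m) ∧
      ⁅layer n c (2 * m + 2), layer n c 1⁆ =
        2 * layer n (c + 1) (2 * m + 1) + 2 * layer n c (2 * m + 3) := by
  have key : ∀ j, _ := fun j => chainProd_comm_aligned (p := 2 * j + c) (Q := layer n c 1)
    (bond_sq n)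
    (fun i => by
      have := bond_comm_layer_even (n := n) c (j + i)
      rwa [show 2 * (j + i) + c = 2 * j + c + 2 * i by ring] at this)
    (fun i => by
      have := bond_comm_layer_odd hn c (j + i)
      rwa [show 2 * (j + i) + c = 2 * j + c + 2 * i by ring] at this) m
  generalize layer n c 1 = Q at *
  simp only [Ring.lie_def, layer, Finset.mul_sum, Finset.sum_mul, ← Finset.sum_sub_distrib,
    ← Finset.sum_add_distrib]
  exact ⟨Finset.sum_congr rfl fun j _ => (key j).1, Finset.sum_congr rfl fun j _ => (key j).2⟩

lemma layer_comm_shifted (hn : 2 ≤ n) (c m : ℕ) :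
    ⁅layer n (c + 1) (2 * m + 1), layer n c 1⁆ =
        2 * layer n (c + 1) (2 * m + 2) - 2 * layer n c (2 * m + 2) ∧
      ⁅layer n (c + 1) (2 * m + 2), layer n c 1⁆ =
        -(2 * layer n c (2 * m + 3)) - 2 * layer n (c + 1) (2 * m + 1) := by
  have key : ∀ j, _ := fun j => chainProd_comm_shifted (p := 2 * j + c) (Q := layer n c 1)
    (bond_sq n)
    (fun i => by
      have := bond_comm_layer_even (n := n) c (j + i)
      rwa [show 2 * (j + i) + c = 2 * j + c + 2 * i by ring] at this)
    (fun i => by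
      have := bond_comm_layer_odd hn c (j + i)
      rwa [show 2 * (j + i) + c = 2 * j + c + 2 * i by ring] at this) m
  generalize layer n c 1 = Q at *
  simp only [Ring.lie_def, layer, Finset.mul_sum, Finset.sum_mul, ← Finset.sum_sub_distrib,
    ← Finset.sum_neg_distrib]
  exact ⟨Finset.sum_congr rfl fun j _ => (key j).1, Finset.sum_congr rfl fun j _ => (key j).2⟩

end Bond

/-! ### Dictionary between strings of bonds and Pauli strings. -/

section Explicit

variable {n : ℕ} [NeZero n]

lemma reindex_chainProd_bond (m p l : ℕ) :
    Matrix.reindexAlgEquiv ℂ ℂ (factorPerm (finRotate n ^ m)) (chainProd (bond n) p l) =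
      chainProd (bond n) (2 * m + p) l := by
  have h : ∀ r, Matrix.reindexAlgEquiv ℂ ℂ (factorPerm (finRotate n ^ m)) (bond n r) =
      bond n (2 * m + r) := by
    intro r
    obtain ⟨k, rfl | rfl⟩ := Nat.even_or_odd' r
    · rw [← mul_add, bond_even, bond_even, map_smul, reindex_siteMod, add_comm k m]
    · rw [← add_assoc, ← mul_add, bond_odd, bond_odd, map_smul, map_mul, reindex_siteMod,
        reindex_siteMod, add_comm k m, add_right_comm k 1 m, add_comm k m]
  have := map_chainProd
    (Matrix.reindexAlgEquiv ℂ ℂ (factorPerm (finRotate n ^ m)) : Op n →+* Op n) (bond n) p l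
  simp only [RingHom.coe_coe] at this
  rw [this]
  exact chainProd_congr (fun i => by rw [h, add_assoc]) l

lemma cyc_chainProd_bond (p l : ℕ) : cyc (chainProd (bond n) p l) = layer n p l := by
  simp only [cyc_eq_sum, reindex_chainProd_bond, layer]

/-- Interior `σ_z` factors square away. Each additional pair of bonds contributes `i * i = -1`,
which the anticommutation of `σ_z` with `σ_x` undoes. -/
lemma chainProd_bond_odd (m : ℕ) :
    chainProd (bond n) 1 (2 * m + 1) = Complex.I • (siteMod n sigmaZ 0 *
      chainProd (siteMod n sigmaX) 1 m * siteMod n sigmaZ (m + 1)) := by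
  induction m with
  | zero => simpa using bond_odd n 0
  | succ m ih =>
    have h1 := siteZ_anticomm (n := n) (m + 1)
    have h2 := siteZ_sq (n := n) (m + 1)
    rw [show 2 * (m + 1) + 1 = 2 * m + 1 + 1 + 1 by ring, chainProd_succ, chainProd_succ, ih,
      show 1 + (2 * m + 1) = 2 * (m + 1) by ring,
      show 1 + (2 * m + 1 + 1) = 2 * (m + 1) + 1 by ring, bond_even, bond_odd, chainProd_succ,
      add_comm 1 m]
    simp only [smul_mul_assoc, mul_smul_comm, smul_smul]
    rw [mul_assoc, mul_assoc _ (siteMod n sigmaZ (m + 1)), ← mul_assoc (siteMod n sigmaX (m + 1)),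
      ← mul_assoc (siteMod n sigmaZ (m + 1)), ← mul_assoc (siteMod n sigmaZ (m + 1)), h1, neg_mul,
      mul_assoc (siteMod n sigmaX (m + 1)), h2, Complex.I_mul_I]
    simp [mul_assoc]

/-- A bond `iσ_x` at either end of the odd-start string turns the end factors `σ_z` into `iσ_y` and
`-iσ_y`. -/
lemma chainProd_bond_even (m : ℕ) :
    chainProd (bond n) 0 (2 * m + 3) = -(Complex.I • (siteMod n sigmaY 0 *
      chainProd (siteMod n sigmaX) 1 m * siteMod n sigmaY (m + 1))) := by
  have h1 := siteX_mul_siteZ (n := n) 0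
  have h2 := siteZ_mul_siteX (n := n) (m + 1)
  rw [show 2 * m + 3 = 2 * m + 2 + 1 by ring, chainProd_succ, chainProd_succ' _ _ (2 * m + 1),
    zero_add, zero_add, chainProd_bond_odd, show 2 * m + 2 = 2 * (m + 1) by ring, bond_even,
    show bond n 0 = _ from bond_even n 0]
  have h3 : ∀ u v C w t : Op n, u * (v * C * w) * t = u * v * C * (w * t) := fun u v C w t => by
    simp only [mul_assoc]
  simp only [smul_mul_assoc, mul_smul_comm, smul_smul]
  rw [h3, h1, h2]
  simp [smul_smul]

lemma Y_eq {m : ℕ} (hm : m + 1 < n) : Y n m = -layer n 0 (2 * m + 3) := by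
  rw [← cyc_chainProd_bond, chainProd_bond_even, siteMod_mul_chainProd_mul _ _ hm, Y, ← neg_smul,
    cyc_smul, neg_smul, neg_neg]

lemma Z_eq {m : ℕ} (hm : m + 1 < n) : Z n m = layer n 1 (2 * m + 1) := by
  rw [← cyc_chainProd_bond, chainProd_bond_odd, siteMod_mul_chainProd_mul _ _ hm, Z, cyc_smul]

lemma X_eq : X n = layer n 0 1 := by
  have h := siteMod_mul_chainProd (n := n) sigmaX (m := 0) (NeZero.pos n)
  have h' : (fun i : Fin n => if i.val = 0 then sigmaX else 1) =
      fun i : Fin n => if i.val = 0 then sigmaX else if i.val ≤ 0 then sigmaX else 1 := by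
    ext1 i; split_ifs <;> first | omega | rfl
  rw [← cyc_chainProd_bond, chainProd_one, show bond n 0 = _ from bond_even n 0, X, h', ← h]
  simp [cyc_smul]

lemma XX_eq : XX n = layer n 1 (2 * n - 1) := by
  obtain ⟨m, hm⟩ := Nat.exists_eq_add_of_lt (NeZero.pos n)
  rw [zero_add] at hm
  -- The string closes up: both end factors `σ_z` sit at site 0 and multiply to 1, leaving `σ_x` on
  -- every other site, a translate of `T`.
  have hz : siteMod n sigmaZ (m + 1) = siteMod n sigmaZ 0 := by
    rw [← hm, ← siteMod_add sigmaZ 0, zero_add]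
  rw [← cyc_chainProd_bond, show 2 * n - 1 = 2 * m + 1 by omega, chainProd_bond_odd, cyc_smul, hz,
    siteMod_mul_chainProd _ (show m < n by omega), tensor_mul_siteMod _ _ (NeZero.pos n), XX]
  congr 1
  set T := tensor fun i : Fin n => if i.val + 1 < n then sigmaX else 1 with hT
  have hT1 : (tensor fun i : Fin n => if i.val = 0 then
      (if i.val = 0 then sigmaZ else if i.val ≤ m then sigmaX else 1) * sigmaZ
      else if i.val = 0 then sigmaZ else if i.val ≤ m then sigmaX else 1) =
      Matrix.reindexAlgEquiv ℂ ℂ (factorPerm (finRotate n ^ 1)) T := by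
    rw [hT, reindex_tensor]
    congr 1
    ext1 i
    obtain ⟨k, rfl⟩ : ∃ k, finRotate n k = i := ⟨_, Equiv.apply_symm_apply _ i⟩
    have hk : (finRotate n k).val = (k.val + 1) % n := by
      rw [finRotate_apply]
      simp [Fin.val_add]
    simp only [pow_one, Function.comp_apply, Equiv.symm_apply_apply]
    have := k.isLt
    generalize finRotate n k = q at hk ⊢
    by_cases h : k.val + 1 < n
    · rw [Nat.mod_eq_of_lt h] at hk
      simp [hk, h, show k.val + 1 ≤ m by omega]
    · rw [show k.val + 1 = n by omega, Nat.mod_self] at hk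
      simp [hk, h, sigmaZ_mul_self]
  have hcomp : ∀ (a b : ℕ) (A : Op n), Matrix.reindexAlgEquiv ℂ ℂ (factorPerm (finRotate n ^ a))
      (Matrix.reindexAlgEquiv ℂ ℂ (factorPerm (finRotate n ^ b)) A) =
      Matrix.reindexAlgEquiv ℂ ℂ (factorPerm (finRotate n ^ (a + b))) A := by
    intro a b A
    rw [pow_add]
    rfl
  have hper : finRotate n ^ n = 1 := by
    ext1 i
    have := finRotate_pow_ofNat (n := n) n i
    simpa [Fin.ofNat, Nat.mod_eq_of_lt i.isLt] using this
  rw [hT1, cyc_eq_sum, cyc_eq_sum]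
  simp only [hcomp]
  rw [sum_range_periodic (f := fun a =>
    Matrix.reindexAlgEquiv ℂ ℂ (factorPerm (finRotate n ^ a)) T)]
  intro a
  rw [pow_add, hper, mul_one]

lemma layer_zero_one_eq_H1 : layer n 0 1 = Complex.I • H1 n := by
  simp only [layer, chainProd_one, add_zero, bond_even, ← Finset.smul_sum, H1]
  rw [← Fin.sum_univ_eq_sum_range (fun i => siteMod n sigmaX i)]
  simp only [siteMod_val]

lemma layer_one_one_eq_H0 : layer n 1 1 = Complex.I • H0 n := by
  simp only [layer, chainProd_one, bond_odd, ← Finset.smul_sum, H0]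
  rw [← Fin.sum_univ_eq_sum_range (fun i => siteMod n sigmaZ i * siteMod n sigmaZ (i + 1))]
  simp only [siteMod_val]
  congr 1
  refine Finset.sum_congr rfl fun j _ => ?_
  have := finRotate_ofNat (n := n) j
  rw [siteMod, ← this]
  simp

end Explicit

/-! ### Product-state functionals that detect linear independence. -/

section Expectation

variable {n : ℕ}

/-- The "density matrix" `(1 + x σ_x + y σ_y + z σ_z) / 2`, for arbitrary complex `x`, `y`, `z`. -/
noncomputable def bloch (x y z : ℂ) : Matrix (Fin 2) (Fin 2) ℂ :=
  (1 / 2 : ℂ) • (1 + x • sigmaX + y • sigmaY + z • sigmaZ)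

lemma trace_bloch (x y z : ℂ) : (bloch x y z).trace = 1 := by
  simp [bloch, sigmaX, sigmaY, sigmaZ, Matrix.trace_fin_two]

lemma trace_bloch_sigmaX (x y z : ℂ) : (bloch x y z * sigmaX).trace = x := by
  simp [bloch, sigmaX, sigmaY, sigmaZ, Matrix.trace_fin_two, Matrix.mul_apply]
  ring

lemma trace_bloch_sigmaY (x y z : ℂ) : (bloch x y z * sigmaY).trace = y := by
  simp [bloch, sigmaX, sigmaY, sigmaZ, Matrix.trace_fin_two, Matrix.mul_apply]
  linear_combination -y * Complex.I_sq

lemma trace_bloch_sigmaZ (x y z : ℂ) : (bloch x y z * sigmaZ).trace = z := by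
  simp [bloch, sigmaX, sigmaY, sigmaZ, Matrix.trace_fin_two, Matrix.mul_apply]
  ring

/-- The functional `A ↦ tr (ρ^{⊗ n} A)` of the product state with Bloch vector `(x, y, z)`. -/
noncomputable def expect (n : ℕ) (x y z : ℂ) : Op n →ₗ[ℂ] ℂ :=
  (Matrix.traceLinearMap _ ℂ ℂ).comp
    (LinearMap.mulLeft ℂ (tensor fun _ : Fin n => bloch x y z))

lemma expect_tensor (x y z : ℂ) (A : Fin n → Matrix (Fin 2) (Fin 2) ℂ) :
    expect n x y z (tensor A) = ∏ i, (bloch x y z * A i).trace := by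
  simp [expect, tensor_mul, trace_tensor]

lemma expect_cyc_tensor (x y z : ℂ) (A : Fin n → Matrix (Fin 2) (Fin 2) ℂ) :
    expect n x y z (cyc (tensor A)) = n * ∏ i, (bloch x y z * A i).trace := by
  have h : ∀ p : Equiv.Perm (Fin n), ∏ i, (bloch x y z * (A ∘ p.symm) i).trace =
      ∏ i, (bloch x y z * A i).trace := fun p =>
    Equiv.prod_comp p.symm fun i => (bloch x y z * A i).trace
  simp only [cyc_eq_sum, reindex_tensor, map_sum, expect_tensor, h]
  simp

lemma prod_link {M : Type*} [CommMonoid M] (a b x : M) {k : ℕ} (hk : k + 1 < n) :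
    ∏ i : Fin n, (if i.val = 0 then a else if i.val ≤ k then x else
      if i.val = k + 1 then b else 1) = a * x ^ k * b := by
  obtain ⟨m, rfl⟩ := Nat.exists_eq_add_of_lt hk
  rw [Fin.prod_univ_eq_prod_range (fun i => if i = 0 then a else if i ≤ k then x else
      if i = k + 1 then b else 1) (k + 1 + m + 1), show k + 1 + m + 1 = (k + 2) + m by ring,
    Finset.prod_range_add, Finset.prod_range_succ, Finset.prod_range_succ']
  have h1 : ∏ i ∈ Finset.range k, (if i + 1 = 0 then a else if i + 1 ≤ k then x else
      if i + 1 = k + 1 then b else 1) = x ^ k := by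
    rw [← Finset.card_range k, ← Finset.prod_const, Finset.card_range]
    refine Finset.prod_congr rfl fun i hi => ?_
    have := Finset.mem_range.1 hi
    rw [if_neg (by omega), if_pos (by omega)]
  have h2 : ∏ i ∈ Finset.range m, (if k + 2 + i = 0 then a else if k + 2 + i ≤ k then x else
      if k + 2 + i = k + 1 then b else 1) = 1 := by
    refine Finset.prod_eq_one fun i _ => ?_
    rw [if_neg (by omega), if_neg (by omega), if_neg (by omega)]
  rw [h1, h2]
  simp [mul_comm a]

lemma expect_link (x y z : ℂ) (A B : Matrix (Fin 2) (Fin 2) ℂ) {k : ℕ} (hk : k + 1 < n) :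
    expect n x y z (cyc (link n A B k)) =
      n * ((bloch x y z * A).trace * x ^ k * (bloch x y z * B).trace) := by
  rw [link, expect_cyc_tensor, ← prod_link _ _ x hk]
  congr 1
  refine Finset.prod_congr rfl fun i _ => ?_
  split_ifs <;> simp [trace_bloch, trace_bloch_sigmaX]

lemma expect_Y (x y z : ℂ) {k : ℕ} (hk : k + 1 < n) :
    expect n x y z (Y n k) = Complex.I * n * (y ^ 2 * x ^ k) := by
  rw [Y, map_smul, expect_link x y z _ _ hk, trace_bloch_sigmaY, smul_eq_mul]
  ring

lemma expect_Z (x y z : ℂ) {k : ℕ} (hk : k + 1 < n) :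
    expect n x y z (Z n k) = Complex.I * n * (z ^ 2 * x ^ k) := by
  rw [Z, map_smul, expect_link x y z _ _ hk, trace_bloch_sigmaZ, smul_eq_mul]
  ring

lemma expect_X_independent (x y z : ℂ) : expect n x y z (X n) = expect n x 0 0 (X n) := by
  rw [X, map_smul, map_smul, expect_cyc_tensor, expect_cyc_tensor]
  congr 2
  refine Finset.prod_congr rfl fun i _ => ?_
  split_ifs <;> simp [trace_bloch, trace_bloch_sigmaX]

lemma expect_XX_independent (x y z : ℂ) : expect n x y z (XX n) = expect n x 0 0 (XX n) := by
  rw [XX, map_smul, map_smul, expect_cyc_tensor, expect_cyc_tensor]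
  congr 2
  refine Finset.prod_congr rfl fun i _ => ?_
  split_ifs <;> simp [trace_bloch, trace_bloch_sigmaX]

end Expectation

/-! ### Center of an abstract finite Onsager quotient. -/

section Onsager

variable {L : Type*} [LieRing L] [LieAlgebra ℝ L]

/-- The relations of the finite quotient of the Onsager algebra in which `G 0` and `G (N + 1)`
vanish: brackets with the two generators `a 0` and `b 0`, and linear independence of the elements
that occur in them. -/
structure OnsagerRelations (a b G : ℕ → L) (N : ℕ) : Prop where
  a_a : ∀ m, ⁅a m, a 0⁆ = (-2 : ℝ) • G m
  b_a : ∀ m, ⁅b m, a 0⁆ = (-2 : ℝ) • G (m + 1)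
  a_b : ∀ m, ⁅a m, b 0⁆ = (2 : ℝ) • G (m + 1)
  b_b : ∀ m, ⁅b m, b 0⁆ = (2 : ℝ) • G m
  G_a : ∀ m, ⁅G (m + 1), a 0⁆ = (4 : ℝ) • (a (m + 1) + b m)
  G_b : ∀ m, ⁅G (m + 1), b 0⁆ = (-4 : ℝ) • (a m + b (m + 1))
  G_zero : G 0 = 0
  G_last : G (N + 1) = 0
  indep : ∀ c g : ℕ → ℝ,
    ∑ m ∈ Finset.range N, (c m • G (m + 1) + g m • (a (m + 1) + b m)) = 0 →
      ∀ m < N, c m = 0 ∧ g m = 0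

lemma lie_eq_zero_of_mem_lieSpan {s : Set L} {v y : L} (hs : ∀ x ∈ s, ⁅v, x⁆ = 0)
    (hy : y ∈ LieSubalgebra.lieSpan ℝ L s) : ⁅v, y⁆ = 0 := by
  induction hy using LieSubalgebra.lieSpan_induction with
  | mem x h => exact hs x h
  | zero => exact lie_zero v
  | add x y _ _ hx hy => rw [lie_add, hx, hy, add_zero]
  | smul c x _ hx => rw [lie_smul, hx, smul_zero]
  | lie x y _ _ hx hy => rw [leibniz_lie, hx, hy, zero_lie, lie_zero, add_zero]

/-- By the Jacobi identity, stability of `V` under bracketing with generators propagates to iterated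
brackets, so `V` need not be known to be a subalgebra. -/
lemma lieSpan_le_of_lie_mem {s : Set L} {V : Submodule ℝ L} (hsV : s ⊆ V)
    (h : ∀ v ∈ V, ∀ x ∈ s, ⁅v, x⁆ ∈ V) :
    ∀ y ∈ LieSubalgebra.lieSpan ℝ L s, y ∈ V := by
  have key : ∀ y ∈ LieSubalgebra.lieSpan ℝ L s, y ∈ V ∧ ∀ v ∈ V, ⁅v, y⁆ ∈ V := by
    intro y hy
    induction hy using LieSubalgebra.lieSpan_induction with
    | mem x hx => exact ⟨hsV hx, fun v hv => h v hv x hx⟩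
    | zero => exact ⟨V.zero_mem, fun v _ => by rw [lie_zero]; exact V.zero_mem⟩
    | add x y _ _ hx hy =>
      exact ⟨V.add_mem hx.1 hy.1, fun v hv => by
        rw [lie_add]; exact V.add_mem (hx.2 v hv) (hy.2 v hv)⟩
    | smul c x _ hx =>
      exact ⟨V.smul_mem c hx.1, fun v hv => by rw [lie_smul]; exact V.smul_mem c (hx.2 v hv)⟩
    | lie x y _ _ hx hy =>
      refine ⟨hy.2 x hx.1, fun v hv => ?_⟩
      rw [leibniz_lie]
      refine V.add_mem (hy.2 _ (hx.2 v hv)) ?_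
      rw [← lie_skew]
      exact V.neg_mem (hx.2 _ (hy.2 v hv))
  exact fun y hy => (key y hy).1

/-- The alternating sum `-a 0 + b 1 - a 2 + b 3 - ⋯`, up to the index `N`. -/
def altSum (a b : ℕ → L) (N : ℕ) : L :=
  ∑ m ∈ Finset.range (N + 1), if Even m then -a m else b m

namespace OnsagerRelations

variable {a b G : ℕ → L} {N : ℕ} (h : OnsagerRelations a b G N)
include h

/-- Climbing: `b m` yields `G (m + 1)`, whose brackets with `a 0` and `b 0` yield `a (m + 1) + b m`
and `a m + b (m + 1)`. -/
lemma mem_lieSpan (m : ℕ) :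
    a m ∈ LieSubalgebra.lieSpan ℝ L {b 0, a 0} ∧ b m ∈ LieSubalgebra.lieSpan ℝ L {b 0, a 0} := by
  set K := LieSubalgebra.lieSpan ℝ L {b 0, a 0} with hK
  have hb0 : b 0 ∈ K := LieSubalgebra.subset_lieSpan (by simp)
  have ha0 : a 0 ∈ K := LieSubalgebra.subset_lieSpan (by simp)
  have smul_mem' : ∀ (c : ℝ) (x : L), c ≠ 0 → c • x ∈ K → x ∈ K := fun c x hc hx => by
    have := K.smul_mem c⁻¹ hx
    rwa [smul_smul, inv_mul_cancel₀ hc, one_smul] at this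
  induction m with
  | zero => exact ⟨ha0, hb0⟩
  | succ m ih =>
    have hG : G (m + 1) ∈ K := smul_mem' (-2) _ (by norm_num) (h.b_a m ▸ K.lie_mem ih.2 ha0)
    have h1 := smul_mem' 4 _ (by norm_num) (h.G_a m ▸ K.lie_mem hG ha0)
    have h2 := smul_mem' (-4) _ (by norm_num) (h.G_b m ▸ K.lie_mem hG hb0)
    exact ⟨by simpa using K.sub_mem h1 ih.2, by simpa using K.sub_mem h2 ih.1⟩

lemma exists_coeff {v : L} (hv : v ∈ LieSubalgebra.lieSpan ℝ L {b 0, a 0}) :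
    ∃ α β g : ℕ → ℝ, v = ∑ m ∈ Finset.range (N + 1), (α m • a m + β m • b m) +
      ∑ m ∈ Finset.range N, g m • G (m + 1) := by
  set S : Set L := {x | ∃ m, m < N + 1 ∧ (x = a m ∨ x = b m)} ∪ {x | ∃ m, m < N ∧ x = G (m + 1)}
    with hS
  have ha : ∀ m, m < N + 1 → a m ∈ Submodule.span ℝ S := fun m hm =>
    Submodule.subset_span (Or.inl ⟨m, hm, Or.inl rfl⟩)
  have hb : ∀ m, m < N + 1 → b m ∈ Submodule.span ℝ S := fun m hm =>
    Submodule.subset_span (Or.inl ⟨m, hm, Or.inr rfl⟩)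
  have hG : ∀ m, m ≤ N + 1 → G m ∈ Submodule.span ℝ S := by
    intro m hm
    rcases m with _ | m
    · rw [h.G_zero]; exact Submodule.zero_mem _
    · rcases Nat.lt_or_ge m N with hm' | hm'
      · exact Submodule.subset_span (Or.inr ⟨m, hm', rfl⟩)
      · rw [show m = N by omega, h.G_last]; exact Submodule.zero_mem _
  have hvS : v ∈ Submodule.span ℝ S := by
    refine lieSpan_le_of_lie_mem ?_ ?_ v hv
    · rintro x (rfl | rfl)
      exacts [hb 0 (by omega), ha 0 (by omega)]
    · rintro w hw x hx
      induction hw using Submodule.span_induction with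
      | zero => rw [zero_lie]; exact Submodule.zero_mem _
      | add y z _ _ hy hz => rw [add_lie]; exact Submodule.add_mem _ hy hz
      | smul c y _ hy => rw [smul_lie]; exact Submodule.smul_mem _ c hy
      | mem y hy =>
        rcases hx with rfl | rfl <;> rcases hy with ⟨m, hm, rfl | rfl⟩ | ⟨m, hm, rfl⟩
        · rw [h.a_b]; exact Submodule.smul_mem _ _ (hG _ (by omega))
        · rw [h.b_b]; exact Submodule.smul_mem _ _ (hG _ (by omega))
        · rw [h.G_b]
          exact Submodule.smul_mem _ _ (Submodule.add_mem _ (ha _ (by omega)) (hb _ (by omega)))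
        · rw [h.a_a]; exact Submodule.smul_mem _ _ (hG _ (by omega))
        · rw [h.b_a]; exact Submodule.smul_mem _ _ (hG _ (by omega))
        · rw [h.G_a]
          exact Submodule.smul_mem _ _ (Submodule.add_mem _ (ha _ (by omega)) (hb _ (by omega)))
  clear hv
  induction hvS using Submodule.span_induction with
  | zero => exact ⟨0, 0, 0, by simp⟩
  | add y z _ _ hy hz =>
    obtain ⟨α, β, g, rfl⟩ := hy
    obtain ⟨α', β', g', rfl⟩ := hz
    refine ⟨α + α', β + β', g + g', ?_⟩
    simp only [Pi.add_apply, add_smul, Finset.sum_add_distrib]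
    abel
  | smul c y _ hy =>
    obtain ⟨α, β, g, rfl⟩ := hy
    refine ⟨c • α, c • β, c • g, ?_⟩
    simp only [Pi.smul_apply, smul_eq_mul, mul_smul, smul_add, Finset.smul_sum]
  | mem y hy =>
    rcases hy with ⟨m, hm, rfl | rfl⟩ | ⟨m, hm, rfl⟩
    · exact ⟨Pi.single m 1, 0, 0, by simp [Pi.single_apply, ite_smul]; omega⟩
    · exact ⟨0, Pi.single m 1, 0, by simp [Pi.single_apply, ite_smul]; omega⟩
    · exact ⟨0, 0, Pi.single m 1, by simp [Pi.single_apply, ite_smul]; omega⟩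

/-- The brackets telescope, leaving only boundary terms in `G 0` and `G (N + 1)`. The next three
lemmas work the same way. -/
lemma altSum_lie_left : ⁅altSum a b N, a 0⁆ = 0 := by
  have : ∀ m, ⁅if Even m then -a m else b m, a 0⁆ =
      (if Even (m + 1) then (-2 : ℝ) • G (m + 1) else 0) - if Even m then (-2 : ℝ) • G m else 0 := by
    intro m
    by_cases hm : Even m <;> simp [hm, Nat.even_add_one, h.a_a, h.b_a]
  rw [altSum, sum_lie, Finset.sum_congr rfl fun m _ => this m,
    Finset.sum_range_sub fun m => if Even m then (-2 : ℝ) • G m else 0]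
  simp [h.G_zero, h.G_last]

lemma altSum_lie_right : ⁅altSum a b N, b 0⁆ = 0 := by
  have : ∀ m, ⁅if Even m then -a m else b m, b 0⁆ =
      (if Even (m + 1) then 0 else (-2 : ℝ) • G (m + 1)) - if Even m then 0 else (-2 : ℝ) • G m := by
    intro m
    by_cases hm : Even m <;> simp [hm, Nat.even_add_one, h.a_b, h.b_b]
  rw [altSum, sum_lie, Finset.sum_congr rfl fun m _ => this m,
    Finset.sum_range_sub fun m => if Even m then 0 else (-2 : ℝ) • G m]
  simp [h.G_last]

lemma altSum_swap_lie_left : ⁅altSum (fun m => -b m) (fun m => -a m) N, a 0⁆ = 0 := by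
  have : ∀ m, ⁅if Even m then - -b m else -a m, a 0⁆ =
      (if Even (m + 1) then 0 else (-2 : ℝ) • G (m + 1)) - if Even m then 0 else (-2 : ℝ) • G m := by
    intro m
    by_cases hm : Even m <;> simp [hm, Nat.even_add_one, h.a_a, h.b_a]
  rw [altSum, sum_lie, Finset.sum_congr rfl fun m _ => this m,
    Finset.sum_range_sub fun m => if Even m then 0 else (-2 : ℝ) • G m]
  simp [h.G_last]

lemma altSum_swap_lie_right : ⁅altSum (fun m => -b m) (fun m => -a m) N, b 0⁆ = 0 := by
  have : ∀ m, ⁅if Even m then - -b m else -a m, b 0⁆ =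
      (if Even (m + 1) then (-2 : ℝ) • G (m + 1) else 0) - if Even m then (-2 : ℝ) • G m else 0 := by
    intro m
    by_cases hm : Even m <;> simp [hm, Nat.even_add_one, h.a_b, h.b_b]
  rw [altSum, sum_lie, Finset.sum_congr rfl fun m _ => this m,
    Finset.sum_range_sub fun m => if Even m then (-2 : ℝ) • G m else 0]
  simp [h.G_zero, h.G_last]

/-- Only the combinations occurring in brackets with `a 0` need to be independent; the expansion of
`v` itself need not be unique. -/
lemma mem_span_of_lie_eq_zero {v : L} (hv : v ∈ LieSubalgebra.lieSpan ℝ L {b 0, a 0})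
    (ha : ⁅v, a 0⁆ = 0) (hb : ⁅v, b 0⁆ = 0) :
    v ∈ Submodule.span ℝ {altSum a b N, altSum (fun m => -b m) (fun m => -a m) N} := by
  obtain ⟨α, β, g, rfl⟩ := h.exists_coeff hv
  have shift : ∀ α : ℕ → ℝ, ∑ m ∈ Finset.range (N + 1), α m • G m =
      ∑ m ∈ Finset.range N, α (m + 1) • G (m + 1) := fun α => by
    rw [Finset.sum_range_succ', h.G_zero, smul_zero, add_zero]
  have trunc : ∀ α : ℕ → ℝ, ∑ m ∈ Finset.range (N + 1), α m • G (m + 1) =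
      ∑ m ∈ Finset.range N, α m • G (m + 1) := fun α => by
    rw [Finset.sum_range_succ, h.G_last, smul_zero, add_zero]
  have key1 := h.indep (fun m => -2 * (α (m + 1) + β m)) (fun m => 4 * g m) (by
    rw [← ha]
    simp only [add_lie, sum_lie, smul_lie, h.a_a, h.b_a, h.G_a, Finset.sum_add_distrib]
    simp only [smul_comm _ (-2 : ℝ), ← Finset.smul_sum, shift, trunc]
    simp only [Finset.smul_sum, ← Finset.sum_add_distrib]
    exact Finset.sum_congr rfl fun m _ => by module)
  have hg : ∀ m < N, g m = 0 := fun m hm => by simpa using (key1 m hm).2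
  have hgs : ∑ m ∈ Finset.range N, g m • G (m + 1) = 0 :=
    Finset.sum_eq_zero fun m hm => by rw [hg m (Finset.mem_range.1 hm), zero_smul]
  rw [hgs, add_zero] at hb ⊢
  have key2 := h.indep (fun m => 2 * (α m + β (m + 1))) 0 (by
    rw [← hb]
    simp only [sum_lie, add_lie, smul_lie, h.a_b, h.b_b, Finset.sum_add_distrib]
    simp only [smul_comm _ (2 : ℝ), ← Finset.smul_sum, shift, trunc]
    simp only [Finset.smul_sum, ← Finset.sum_add_distrib]
    exact Finset.sum_congr rfl fun m _ => by simp; module)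
  have h1 : ∀ m < N, α (m + 1) = -β m := fun m hm => by
    have := (key1 m hm).1
    linarith
  have h2 : ∀ m < N, β (m + 1) = -α m := fun m hm => by
    have := (key2 m hm).1
    linarith
  have coeff : ∀ m < N + 1, α m = (if Even m then α 0 else -β 0) ∧
      β m = if Even m then β 0 else -α 0 := by
    intro m
    induction m with
    | zero => simp
    | succ m ih =>
      intro hm
      rw [h1 m (by omega), h2 m (by omega), (ih (by omega)).1, (ih (by omega)).2]
      by_cases hm : Even m <;> simp [hm, Nat.even_add_one]
  -- The two alternating sums begin with `-a 0` and `b 0`, hence these coefficients.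
  refine Submodule.mem_span_pair.2 ⟨-α 0, β 0, ?_⟩
  rw [altSum, altSum, Finset.smul_sum, Finset.smul_sum, ← Finset.sum_add_distrib]
  refine Finset.sum_congr rfl fun m hm => ?_
  obtain ⟨hα, hβ⟩ := coeff m (Finset.mem_range.1 hm)
  rw [hα, hβ]
  split_ifs <;> module

lemma mem_lieSpan_and_central_iff (v : L) :
    (v ∈ LieSubalgebra.lieSpan ℝ L {b 0, a 0} ∧
      ∀ y ∈ LieSubalgebra.lieSpan ℝ L {b 0, a 0}, ⁅y, v⁆ = 0) ↔
    v ∈ Submodule.span ℝ {altSum a b N, altSum (fun m => -b m) (fun m => -a m) N} := by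
  set K := LieSubalgebra.lieSpan ℝ L {b 0, a 0} with hK
  constructor
  · rintro ⟨hv, hc⟩
    refine h.mem_span_of_lie_eq_zero hv ?_ ?_ <;> rw [← lie_skew, hc, neg_zero]
    · exact LieSubalgebra.subset_lieSpan (by simp)
    · exact LieSubalgebra.subset_lieSpan (by simp)
  · intro hv
    obtain ⟨s, t, rfl⟩ := Submodule.mem_span_pair.1 hv
    refine ⟨K.add_mem (K.smul_mem s ?_) (K.smul_mem t ?_), fun y hy => ?_⟩
    · refine sum_mem fun m _ => ?_
      split_ifs
      exacts [neg_mem (h.mem_lieSpan m).1, (h.mem_lieSpan m).2]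
    · refine sum_mem fun m _ => ?_
      split_ifs
      exacts [neg_mem (neg_mem (h.mem_lieSpan m).2), neg_mem (h.mem_lieSpan m).1]
    · rw [← lie_skew, lie_eq_zero_of_mem_lieSpan _ hy, neg_zero]
      rintro x (rfl | rfl)
      · rw [add_lie, smul_lie, smul_lie, h.altSum_lie_right, h.altSum_swap_lie_right]
        simp
      · rw [add_lie, smul_lie, smul_lie, h.altSum_lie_left, h.altSum_swap_lie_left]
        simp

end OnsagerRelations

end Onsager

/-! ### Complex conjugation as a grading by string length. -/

section Conjugation

variable {n : ℕ}

/-- Entrywise complex conjugation of operators. -/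
noncomputable def entryConj (n : ℕ) : Op n →+* Op n := (starRingEnd ℂ).mapMatrix

lemma entryConj_smul (c : ℂ) (A : Op n) : entryConj n (c • A) = star c • entryConj n A := by
  ext r s
  simp [entryConj]

lemma entryConj_real_smul (c : ℝ) (A : Op n) : entryConj n (c • A) = c • entryConj n A := by
  ext r s
  simp [entryConj]

variable [NeZero n]

lemma entryConj_siteMod {σ : Matrix (Fin 2) (Fin 2) ℂ} (hσ : ∀ i j, star (σ i j) = σ i j)
    (k : ℕ) : entryConj n (siteMod n σ k) = siteMod n σ k := by
  ext r s
  simp only [entryConj, RingHom.mapMatrix_apply, Matrix.map_apply, siteMod, site, tensor,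
    Matrix.of_apply, map_prod]
  refine Finset.prod_congr rfl fun i _ => ?_
  by_cases h : i = Fin.ofNat n k
  · subst h; simpa using hσ _ _
  · rw [Function.update_of_ne h, Matrix.one_apply]
    split_ifs <;> simp

/-- Each bond is `i` times a real matrix, so conjugation reads off the parity of the length of a
string. -/
lemma entryConj_bond (r : ℕ) : entryConj n (bond n r) = -bond n r := by
  have hX : ∀ k, entryConj n (siteMod n sigmaX k) = siteMod n sigmaX k :=
    entryConj_siteMod fun i j => by fin_cases i <;> fin_cases j <;> simp [sigmaX]
  have hZ : ∀ k, entryConj n (siteMod n sigmaZ k) = siteMod n sigmaZ k :=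
    entryConj_siteMod fun i j => by fin_cases i <;> fin_cases j <;> simp [sigmaZ]
  obtain ⟨k, rfl | rfl⟩ := Nat.even_or_odd' r
  · rw [bond_even, entryConj_smul, hX]; simp
  · rw [bond_odd, entryConj_smul, map_mul, hZ, hZ]; simp

lemma entryConj_layer (c l : ℕ) : entryConj n (layer n c l) = (-1) ^ l * layer n c l := by
  simp only [layer, map_sum, map_chainProd, entryConj_bond, chainProd_neg, Finset.mul_sum]

lemma entryConj_layer_even (c m : ℕ) : entryConj n (layer n c (2 * m)) = layer n c (2 * m) := by
  rw [entryConj_layer, (even_two_mul m).neg_one_pow, one_mul]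

lemma entryConj_layer_odd (c m : ℕ) :
    entryConj n (layer n c (2 * m + 1)) = -layer n c (2 * m + 1) := by
  rw [entryConj_layer, (odd_two_mul_add_one m).neg_one_pow, neg_one_mul]

end Conjugation

/-! ### The spin chain realizes the Onsager relations; its center. -/

section Center

lemma mem_dlaCenter_iff {n : ℕ} (v : Op n) :
    v ∈ dlaCenter n ↔ v ∈ dla n ∧ ∀ y ∈ dla n, ⁅y, v⁆ = 0 := by
  simp only [dlaCenter, Submodule.mem_map]
  constructor
  · rintro ⟨⟨w, hw⟩, hc, rfl⟩
    refine ⟨hw, fun y hy => ?_⟩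
    have := (LieModule.mem_maxTrivSubmodule ℝ (dla n) (dla n) ⟨w, hw⟩).1 hc ⟨y, hy⟩
    exact congrArg Subtype.val this
  · rintro ⟨hv, hc⟩
    refine ⟨⟨v, hv⟩, (LieModule.mem_maxTrivSubmodule ℝ (dla n) (dla n) ⟨v, hv⟩).2 ?_, rfl⟩
    rintro ⟨y, hy⟩
    exact Subtype.ext (hc y hy)

variable {n : ℕ} [NeZero n]

/-- With Bloch vector (x, 0, 1) the first layer, which is `-Y n m`, has expectation 0 and the
second, `Z n m`, has `i n x^m`. The relation becomes a polynomial vanishing at every `x`. -/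
lemma eq_zero_of_sum_smul_layer {N : ℕ} (hN : n = N + 1) {g : ℕ → ℝ}
    (hg : ∑ m ∈ Finset.range N, g m • (layer n 0 (2 * (m + 1) + 1) + layer n 1 (2 * m + 1)) = 0) :
    ∀ m < N, g m = 0 := by
  have hx : ∀ x : ℂ, ∑ m ∈ Finset.range N, (g m : ℂ) * x ^ m = 0 := by
    intro x
    have h := congrArg (expect n x 0 1) hg
    have hterm : ∀ m ∈ Finset.range N, expect n x 0 1
        (g m • (layer n 0 (2 * (m + 1) + 1) + layer n 1 (2 * m + 1))) =
        Complex.I * n * ((g m : ℂ) * x ^ m) := by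
      intro m hm
      have hm' : m + 1 < n := by have := Finset.mem_range.1 hm; omega
      have e1 := expect_Y x 0 1 hm'
      have e2 := expect_Z x 0 1 hm'
      rw [Y_eq hm', map_neg] at e1
      rw [Z_eq hm'] at e2
      rw [← Complex.coe_smul, map_smul, map_add, e2, show 2 * (m + 1) + 1 = 2 * m + 3 by ring,
        smul_eq_mul]
      linear_combination -(g m : ℂ) * e1
    rw [map_sum, map_zero, Finset.sum_congr rfl hterm, ← Finset.mul_sum] at h
    have hn : (n : ℂ) ≠ 0 := Nat.cast_ne_zero.2 (NeZero.ne n)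
    simpa [hn] using h
  have hP : ∑ m ∈ Finset.range N, Polynomial.C (g m : ℂ) * Polynomial.X ^ m = 0 :=
    Polynomial.funext fun x => by simpa [Polynomial.eval_finsetSum] using hx x
  intro m hm
  have := congrArg (fun p => Polynomial.coeff p m) hP
  simpa [Polynomial.finsetSum_coeff, Polynomial.coeff_X_pow, hm] using this

lemma onsagerRelations_layer {N : ℕ} (hn : 2 ≤ n) (hN : n = N + 1) :
    OnsagerRelations (fun m => layer n 0 (2 * m + 1)) (fun m => layer n 1 (2 * m + 1))
      (fun m => layer n 0 (2 * m) - layer n 1 (2 * m)) N := by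
  have A0 := layer_comm_aligned hn 0
  have S0 := layer_comm_shifted hn 0
  have A1 := layer_comm_aligned hn 1
  have S1 := layer_comm_shifted hn 1
  simp only [zero_add, show ∀ l, layer n (1 + 1) l = layer n 0 l from layer_add_two 0,
    two_mul (layer n _ _)] at A0 S0 A1 S1
  have G_a : ∀ m, ⁅layer n 0 (2 * (m + 1)) - layer n 1 (2 * (m + 1)), layer n 0 1⁆ =
      (4 : ℝ) • (layer n 0 (2 * (m + 1) + 1) + layer n 1 (2 * m + 1)) := fun m => by
    rw [sub_lie, show 2 * (m + 1) = 2 * m + 2 by ring, (A0 m).2, (S0 m).2]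
    module
  refine ⟨fun m => ?_, fun m => ?_, fun m => ?_, fun m => ?_, G_a, fun m => ?_, ?_, ?_, ?_⟩
  · change ⁅layer n 0 (2 * m + 1), layer n 0 1⁆ = _
    rw [(A0 m).1]; module
  · change ⁅layer n 1 (2 * m + 1), layer n 0 1⁆ = _
    rw [(S0 m).1, show 2 * (m + 1) = 2 * m + 2 by ring]; module
  · change ⁅layer n 0 (2 * m + 1), layer n 1 1⁆ = _
    rw [(S1 m).1, show 2 * (m + 1) = 2 * m + 2 by ring]; module
  · change ⁅layer n 1 (2 * m + 1), layer n 1 1⁆ = _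
    rw [(A1 m).1]; module
  · change ⁅layer n 0 (2 * (m + 1)) - layer n 1 (2 * (m + 1)), layer n 1 1⁆ =
      (-4 : ℝ) • (layer n 0 (2 * m + 1) + layer n 1 (2 * (m + 1) + 1))
    rw [sub_lie, show 2 * (m + 1) = 2 * m + 2 by ring, (A1 m).2, (S1 m).2]
    module
  · exact sub_eq_zero.2 (layer_zero 1).symm
  · rw [← hN]
    exact sub_eq_zero.2 (layer_full hn).symm
  · intro c g h
    simp only [Finset.sum_add_distrib] at h
    -- Conjugation fixes the `G`-part and negates the rest, so both parts vanish separately.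
    have h' := congrArg (entryConj n) h
    simp only [map_add, map_sum, map_sub, entryConj_real_smul, entryConj_layer_even,
      entryConj_layer_odd, map_zero, ← neg_add, smul_neg, Finset.sum_neg_distrib] at h'
    rw [← sub_eq_add_neg, sub_eq_zero] at h'
    have hg : ∑ m ∈ Finset.range N,
        g m • (layer n 0 (2 * (m + 1) + 1) + layer n 1 (2 * m + 1)) = 0 := by
      rw [h', ← two_smul ℝ] at h
      exact (smul_eq_zero.1 h).resolve_left two_ne_zero
    rw [hg] at h'
    -- Bracketing with `a 0` sends `G (m + 1)` to `4 (a (m + 1) + b m)`, which reduces the `G`-part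
    -- to the case already settled.
    have hc := congrArg (fun v => ⁅v, layer n 0 1⁆) h'
    simp only [sum_lie, smul_lie, zero_lie, G_a, smul_smul] at hc
    have hc := eq_zero_of_sum_smul_layer hN hc
    have hg := eq_zero_of_sum_smul_layer hN hg
    exact fun m hm => ⟨by simpa using hc m hm, hg m hm⟩

lemma altSum_layer {N : ℕ} (hN : n = N + 1) :
    altSum (fun m => layer n 0 (2 * m + 1)) (fun m => layer n 1 (2 * m + 1)) N =
      -X n + (if Even N then 0 else XX n) + oddSum n := by
  have hXX : layer n 1 (2 * N + 1) = XX n := by rw [XX_eq]; congr 1; omega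
  have hsplit : ∀ m, (if Even m then -layer n 0 (2 * m + 1) else layer n 1 (2 * m + 1)) =
      (if Even m then -layer n 0 (2 * m + 1) else 0) +
        if Even m then 0 else layer n 1 (2 * m + 1) := by
    intro m; split_ifs <;> simp
  -- Since `Y n m` is `-a (m + 1)` and `Z n m` is `b m`, the `a`-sum loses its first term (`X`) and
  -- the `b`-sum its last (`XX`).
  rw [altSum, Finset.sum_congr rfl fun m _ => hsplit m, Finset.sum_add_distrib,
    Finset.sum_range_succ', Finset.sum_range_succ, hXX, oddSum, Finset.sum_filter,
    show n - 1 = N by omega]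
  have : ∀ m ∈ Finset.range N, (if Odd m then Y n m + Z n m else 0) =
      (if Even (m + 1) then -layer n 0 (2 * (m + 1) + 1) else 0) +
        if Even m then 0 else layer n 1 (2 * m + 1) := by
    intro m hm
    have hm' : m + 1 < n := by have := Finset.mem_range.1 hm; omega
    rw [Y_eq hm', Z_eq hm', show 2 * (m + 1) + 1 = 2 * m + 3 by ring]
    by_cases h : Even m <;> simp [h, Nat.even_add_one]
  rw [Finset.sum_congr rfl this, Finset.sum_add_distrib, X_eq]
  simp only [Even.zero, if_true, mul_zero, zero_add]
  abel

lemma altSum_swap_layer {N : ℕ} (hN : n = N + 1) :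
    altSum (fun m => -layer n 1 (2 * m + 1)) (fun m => -layer n 0 (2 * m + 1)) N =
      (if Even N then XX n else 0) + evenSum n := by
  have hXX : layer n 1 (2 * N + 1) = XX n := by rw [XX_eq]; congr 1; omega
  have hsplit : ∀ m, (if Even m then - -layer n 1 (2 * m + 1) else -layer n 0 (2 * m + 1)) =
      (if Even m then layer n 1 (2 * m + 1) else 0) +
        if Even m then 0 else -layer n 0 (2 * m + 1) := by
    intro m; split_ifs <;> simp
  rw [altSum, Finset.sum_congr rfl fun m _ => hsplit m, Finset.sum_add_distrib,
    Finset.sum_range_succ, Finset.sum_range_succ', hXX, evenSum, Finset.sum_filter,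
    show n - 1 = N by omega]
  have : ∀ m ∈ Finset.range N, (if Even m then Y n m + Z n m else 0) =
      (if Even m then layer n 1 (2 * m + 1) else 0) +
        if Even (m + 1) then 0 else -layer n 0 (2 * (m + 1) + 1) := by
    intro m hm
    have hm' : m + 1 < n := by have := Finset.mem_range.1 hm; omega
    rw [Y_eq hm', Z_eq hm', show 2 * (m + 1) + 1 = 2 * m + 3 by ring]
    by_cases h : Even m <;> simp [h, Nat.even_add_one, add_comm]
  rw [Finset.sum_congr rfl this, Finset.sum_add_distrib]
  simp only [Even.zero, if_true]
  abel

lemma dlaCenter_eq {N : ℕ} (hn : 2 ≤ n) (hN : n = N + 1) :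
    dlaCenter n = Submodule.span ℝ {-X n + (if Even N then 0 else XX n) + oddSum n,
      (if Even N then XX n else 0) + evenSum n} := by
  have h := (onsagerRelations_layer hn hN).mem_lieSpan_and_central_iff
  simp only [mul_zero, zero_add, altSum_layer hN, altSum_swap_layer hN, layer_zero_one_eq_H1,
    layer_one_one_eq_H0] at h
  ext v
  rw [mem_dlaCenter_iff]
  exact h v

end Center

/-! ### Linear independence of the two central elements. -/

section Dimension

variable {n : ℕ}

/-- The dependence of the expectation in a product state on the component `z`, which the
operators `𝐗` and `𝐗𝐗` do not contribute to. -/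
noncomputable def expectDiff (n : ℕ) (x : ℂ) : Op n →ₗ[ℂ] ℂ := expect n x 0 1 - expect n x 0 0

lemma expectDiff_X (x : ℂ) : expectDiff n x (X n) = 0 := by
  simp [expectDiff, expect_X_independent x 0 1]

lemma expectDiff_XX (x : ℂ) : expectDiff n x (XX n) = 0 := by
  simp [expectDiff, expect_XX_independent x 0 1]

lemma expectDiff_sum (x : ℂ) {s : Finset ℕ} (hs : ∀ k ∈ s, k + 1 < n) :
    expectDiff n x (∑ k ∈ s, (Y n k + Z n k)) = Complex.I * n * ∑ k ∈ s, x ^ k := by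
  rw [map_sum, Finset.mul_sum]
  refine Finset.sum_congr rfl fun k hk => ?_
  simp [expectDiff, expect_Y _ _ _ (hs k hk), expect_Z _ _ _ (hs k hk)]

/-- `A` and `B` absorb the `X` and `XX` terms, so one statement serves both parities of `n`. -/
lemma linearIndependent_central (hn : 3 ≤ n) {A B : Op n}
    (hA : ∀ x, expectDiff n x A = 0) (hB : ∀ x, expectDiff n x B = 0) :
    LinearIndependent ℝ ![A + oddSum n, B + evenSum n] := by
  rw [LinearIndependent.pair_iff]
  intro s t hst
  have hlt : ∀ (p : ℕ → Prop) [DecidablePred p],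
      ∀ k ∈ (Finset.range (n - 1)).filter p, k + 1 < n := by
    intro p _ k hk
    have := Finset.mem_range.1 (Finset.mem_filter.1 hk).1
    omega
  have key : ∀ x : ℂ, s * ∑ k ∈ (Finset.range (n - 1)).filter (fun k => Odd k), x ^ k +
      t * ∑ k ∈ (Finset.range (n - 1)).filter (fun k => Even k), x ^ k = 0 := by
    intro x
    have h := congrArg (expectDiff n x) hst
    rw [← Complex.coe_smul, ← Complex.coe_smul, map_add, map_smul, map_smul, map_add, map_add, hA,
      hB, oddSum, evenSum, expectDiff_sum x (hlt _), expectDiff_sum x (hlt _), map_zero,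
      smul_eq_mul, smul_eq_mul] at h
    have hn0 : (n : ℂ) ≠ 0 := Nat.cast_ne_zero.2 (by omega)
    refine (mul_eq_zero.1 (?_ : Complex.I * n * _ = 0)).resolve_left
      (mul_ne_zero Complex.I_ne_zero hn0)
    linear_combination h
  -- Evaluating at 1 and -1 separates the odd powers from the even ones.
  have h1 := key 1
  have h2 := key (-1)
  have ho : ∑ k ∈ (Finset.range (n - 1)).filter (fun k => Odd k), (-1 : ℂ) ^ k =
      ∑ k ∈ (Finset.range (n - 1)).filter (fun k => Odd k), (-1 : ℂ) :=
    Finset.sum_congr rfl fun k hk => (Finset.mem_filter.1 hk).2.neg_one_pow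
  have he : ∑ k ∈ (Finset.range (n - 1)).filter (fun k => Even k), (-1 : ℂ) ^ k =
      ∑ k ∈ (Finset.range (n - 1)).filter (fun k => Even k), (1 : ℂ) :=
    Finset.sum_congr rfl fun k hk => (Finset.mem_filter.1 hk).2.neg_one_pow
  rw [ho, he] at h2
  simp only [one_pow, Finset.sum_const, nsmul_eq_mul, mul_one, mul_neg] at h1 h2
  -- Here `3 ≤ n` matters: the odd index 1 must lie below `n - 1`.
  have co : (((Finset.range (n - 1)).filter (fun k => Odd k)).card : ℂ) ≠ 0 :=
    Nat.cast_ne_zero.2 (Finset.card_ne_zero_of_mem (a := 1) (by simp; omega))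
  have ce : (((Finset.range (n - 1)).filter (fun k => Even k)).card : ℂ) ≠ 0 :=
    Nat.cast_ne_zero.2 (Finset.card_ne_zero_of_mem (a := 0) (by simp; omega))
  constructor
  · have : (s : ℂ) * ((Finset.range (n - 1)).filter (fun k => Odd k)).card = 0 := by
      linear_combination (h1 - h2) / 2
    exact_mod_cast (mul_eq_zero.1 this).resolve_right co
  · have : (t : ℂ) * ((Finset.range (n - 1)).filter (fun k => Even k)).card = 0 := by
      linear_combination (h1 + h2) / 2
    exact_mod_cast (mul_eq_zero.1 this).resolve_right ce

end Dimension

end IsingChain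

theorem mainTheorem3 (n : ℕ) (hn : 2 ≤ n) :
    (Odd n → IsingChain.dlaCenter n =
      Submodule.span ℝ
        {-IsingChain.X n + IsingChain.oddSum n, IsingChain.XX n + IsingChain.evenSum n}) ∧
    (Even n → IsingChain.dlaCenter n =
      Submodule.span ℝ
        {-IsingChain.X n + IsingChain.XX n + IsingChain.oddSum n, IsingChain.evenSum n}) ∧
    (3 ≤ n → Module.finrank ℝ (IsingChain.dlaCenter n) = 2) := by
  have : NeZero n := ⟨by omega⟩
  obtain ⟨N, hN⟩ : ∃ N, n = N + 1 := ⟨n - 1, by omega⟩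
  have h := IsingChain.dlaCenter_eq hn hN
  refine ⟨fun ho => ?_, fun he => ?_, fun h3 => ?_⟩
  · have : Even N := by subst hN; simpa [Nat.odd_add_one] using ho
    simpa [this] using h
  · have : ¬ Even N := by subst hN; simpa [Nat.even_add_one] using he
    simpa [this] using h
  · have li := IsingChain.linearIndependent_central h3
      (A := -IsingChain.X n + if Even N then 0 else IsingChain.XX n)
      (B := if Even N then IsingChain.XX n else 0)
      (fun x => by split_ifs <;> simp [IsingChain.expectDiff_X, IsingChain.expectDiff_XX])
      (fun x => by split_ifs <;> simp [IsingChain.expectDiff_XX])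
    rw [h]
    have := finrank_span_eq_card li
    rwa [Matrix.range_cons_cons_empty, Fintype.card_fin] at this
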